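/- Let $\lambda$ be a partition of $m$. For $n\ge 0$ let $B(\lambda)_n$ be the crystal of semistandard tableaux of shape $\lambda$ with entries in $\{1,\dots,n\}$: the oriented graph with an edge $T\xrightarrow{\,i\,}T'$ ($1\le i\le n-1$) whenever $T'=f_i(T)$. Here $f_i$ is the usual crystal operator computed on the row reading word (rows read left to right, from the last row to the first): view letters $i$ as ")" and letters $i+1$ as "(", cancel coupled parentheses, and change the letter $i$ of the rightmost uncoupled ")" into $i+1$ ($f_i$ is null if there is none). A set of cells of a tableau consisting of all entries in an interval of values is a horizontal band if, when its cells are listed by increasing entry (left to right among equal entries), each new cell is weakly north-east of the preceding ones and in a new column. The minimal parsing of a tableau is the sequence of its successive maximal horizontal bands, formed starting from the smallest entries, and its descent composition is the sequence of their lengths. A descent of a standard tableau is an entry $i$ such that $i+1$ lies in a row of greater index. For a standard tableau $U$ of shape $\lambda$, let $B(U)_n$ be the set of tableaux of $B(\lambda)_n$ with the same minimal parsing as $U$. The skeleton $\mathrm{Skeleton}(\lambda)_n$ is the labelled oriented graph whose vertices are the standard tableaux $U$ of shape $\lambda$ with $B(U)_n\neq\emptyset$, and which has, for $U\ne V$,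 an edge from $U$ to $V$ exactly when some edge of $B(\lambda)_n$ goes from $B(U)_n$ to $B(V)_n$; this edge is unique and labelled by the least label $i$ of such edges. Theorem. Let $S$ be the maximal length of a descent composition of a tableau of shape $\lambda$. 1. For all $n\ge S$, $\mathrm{Skeleton}(\lambda)_n=\mathrm{Skeleton}(\lambda)_S$ (same vertices, edges and labels). 2. For $1\le n\le S$, $\mathrm{Skeleton}(\lambda)_n$ is the induced subgraph (with its labels) of $\mathrm{Skeleton}(\lambda)_S$ whose vertices are all the standard tableaux of shape $\lambda$ whose descent composition has at most $n$ parts. 3. If $\mathrm{Skeleton}(\lambda)_S$ has an edge between $U$ and $V$, then the numbers of descents of $U$ and $V$ differ by at most $1$. -/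

import Mathlib

/-! ## Labelled oriented graphs -/

/-- An oriented graph with vertices taken from `V` and edges labelled by elements of `L`.
`edge u i v` says that there is an edge from `u` to `v` with label `i`. -/
@[ext]
structure LabelledDigraph (V L : Type*) where
  /-- the vertices -/
  verts : Set V
  /-- the labelled edges -/
  edge : V → L → V → Prop
  /-- edges join vertices -/
  edge_mem : ∀ u i v, edge u i v → u ∈ verts ∧ v ∈ verts

/-- The induced subgraph with vertex set `s`: all edges between elements of `s` are kept, with
their labels (the vertex set is exactly `s`, as for `SimpleGraph.Subgraph.induce`). -/
def LabelledDigraph.induce {V L : Type*} (G : LabelledDigraph V L) (s : Set V) :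
    LabelledDigraph V L where
  verts := s
  edge u i v := u ∈ s ∧ v ∈ s ∧ G.edge u i v
  edge_mem _ _ _ h := ⟨h.1, h.2.1⟩

/-! ## Crystal operators on words and on tableaux -/

/-- Positions of the uncoupled closing parentheses of a word, where a letter `i` is a closing
parenthesis and a letter `i + 1` is an opening one. The word is scanned from left to right;
`d` is the number of opening parentheses still waiting to be coupled and `p` is the position
of the first letter of the remaining word. -/
def uncoupledClosing (i : ℕ) : ℕ → ℕ → List ℕ → List ℕ
  | _, _, [] => []
  | d, p, a :: w =>
    if a = i + 1 then uncoupledClosing i (d + 1) (p + 1) w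
    else if a = i then
      if d = 0 then p :: uncoupledClosing i 0 (p + 1) w
      else uncoupledClosing i (d - 1) (p + 1) w
    else uncoupledClosing i d (p + 1) w

/-- The crystal operator `f_i` on words: it changes into `i + 1` the letter `i` of the rightmost
uncoupled closing parenthesis; it is null (`none`) if there is none. -/
def crystalF (i : ℕ) (w : List ℕ) : Option (List ℕ) :=
  (uncoupledClosing i 0 0 w).getLast?.map fun p => w.set p (i + 1)

/-- The cells of a Young diagram in row reading order: from the last row to the first one, each
row from left to right. -/
def readingCells (μ : YoungDiagram) : List (ℕ × ℕ) :=
  (List.range (μ.colLen 0)).reverse.flatMap fun r => (List.range (μ.rowLen r)).map fun c => (r, c)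

/-- The row reading word of a tableau. -/
def rowWord {μ : YoungDiagram} (T : SemistandardYoungTableau μ) : List ℕ :=
  (readingCells μ).map fun c => T c.1 c.2

/-- The crystal `B(μ)_n`. The vertices are the semistandard tableaux of shape `μ` with entries in
`{1, …, n}`; there is an edge labelled `i`, for `1 ≤ i ≤ n - 1`, from `T` to `T'` when
`T' = f_i(T)`, that is, when `f_i` sends the row reading word of `T` to that of `T'`. -/
def crystal (μ : YoungDiagram) (n : ℕ) : LabelledDigraph (SemistandardYoungTableau μ) ℕ where
  verts := {T | ∀ c ∈ μ.cells, 1 ≤ T c.1 c.2 ∧ T c.1 c.2 ≤ n}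
  edge T i T' :=
    (∀ c ∈ μ.cells, 1 ≤ T c.1 c.2 ∧ T c.1 c.2 ≤ n) ∧
    (∀ c ∈ μ.cells, 1 ≤ T' c.1 c.2 ∧ T' c.1 c.2 ≤ n) ∧
    1 ≤ i ∧ i < n ∧ crystalF i (rowWord T) = some (rowWord T')
  edge_mem _ _ _ h := ⟨h.1, h.2.1⟩

/-! ## Minimal parsing and descent composition -/

/-- The integers which occur as entries of a tableau. -/
def entrySet {μ : YoungDiagram} (T : SemistandardYoungTableau μ) : Finset ℕ :=
  μ.cells.image fun c => T c.1 c.2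

/-- The cells of `T` with entries in `{a, …, b}` form a horizontal band: when they are listed by
increasing entries, and from left to right among equal entries, each new cell is weakly
North-East of the preceding ones and in a new column. (Cells with equal entries satisfy this in
every semistandard tableau, so only cells with different entries are compared.) -/
def IsHorizontalBand {μ : YoungDiagram} (T : SemistandardYoungTableau μ) (a b : ℕ) : Prop :=
  ∀ c ∈ μ.cells, ∀ d ∈ μ.cells,
    a ≤ T c.1 c.2 → T c.1 c.2 < T d.1 d.2 → T d.1 d.2 ≤ b → d.1 ≤ c.1 ∧ c.2 < d.2

instance {μ : YoungDiagram} (T : SemistandardYoungTableau μ) (a b : ℕ) :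
    Decidable (IsHorizontalBand T a b) := by
  unfold IsHorizontalBand
  infer_instance

/-- The entries which start a maximal horizontal band: those that cannot be joined to any
smaller entry in a horizontal band. -/
def bandStarts {μ : YoungDiagram} (T : SemistandardYoungTableau μ) : Finset ℕ :=
  (entrySet T).filter fun v => ∀ u ∈ entrySet T, u < v → ¬ IsHorizontalBand T u v

/-- The rank, counted from `1`, of the maximal horizontal band which contains the cell `c`. -/
def bandIndex {μ : YoungDiagram} (T : SemistandardYoungTableau μ) (c : ℕ × ℕ) : ℕ :=
  ((bandStarts T).filter fun v => v ≤ T c.1 c.2).card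

/-- The minimal parsing of a tableau: its maximal horizontal bands, as sets of cells, in order. -/
def minimalParsing {μ : YoungDiagram} (T : SemistandardYoungTableau μ) :
    List (Finset (ℕ × ℕ)) :=
  (List.range (bandStarts T).card).map fun k => μ.cells.filter fun c => bandIndex T c = k + 1

/-- The descent composition of a tableau: the lengths of its maximal horizontal bands. -/
def descentComposition {μ : YoungDiagram} (T : SemistandardYoungTableau μ) : List ℕ :=
  (minimalParsing T).map Finset.card

/-- The lengths of the descent compositions of the tableaux of shape `μ`, with arbitrary positive
entries. -/
def descentLengths (μ : YoungDiagram) : Set ℕ :=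
  {k | ∃ T : SemistandardYoungTableau μ,
    (∀ c ∈ μ.cells, 1 ≤ T c.1 c.2) ∧ (descentComposition T).length = k}

/-- The maximal length of a descent composition for `μ`. -/
noncomputable def maxDescentLength (μ : YoungDiagram) : ℕ :=
  sSup (descentLengths μ)

/-- The supremum in `maxDescentLength` is a maximum. -/
theorem maxDescentLength_isGreatest (μ : YoungDiagram) :
    IsGreatest (descentLengths μ) (maxDescentLength μ) := by
  have hne : (descentLengths μ).Nonempty := by
    refine ⟨_, ⟨fun r c => if (r, c) ∈ μ then r + 1 else 0, ?_, ?_, ?_⟩, ?_, rfl⟩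
    · intro i j1 j2 hj h
      have h1 : (i, j1) ∈ μ := μ.up_left_mem le_rfl hj.le h
      simp [h, h1]
    · intro i1 i2 j hi h
      have h1 : (i1, j) ∈ μ := μ.up_left_mem hi.le le_rfl h
      simp [h, h1, hi]
    · intro i j h
      simp [h]
    · rintro ⟨r, c⟩ h
      have h1 : (r, c) ∈ μ := h
      change 1 ≤ if (r, c) ∈ μ then r + 1 else 0
      simp [h1]
  have hbd : BddAbove (descentLengths μ) := by
    refine ⟨μ.cells.card, ?_⟩
    rintro k ⟨T, -, rfl⟩
    simp only [descentComposition, minimalParsing, List.length_map, List.length_range]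
    exact (Finset.card_le_card (Finset.filter_subset _ _)).trans Finset.card_image_le
  exact ⟨Nat.sSup_mem hne hbd, fun k hk => le_csSup hbd hk⟩

/-! ## Standard tableaux and the skeleton -/

/-- A tableau is standard if each of `1, …, |μ|` occurs exactly once as an entry. -/
def IsStandard {μ : YoungDiagram} (T : SemistandardYoungTableau μ) : Prop :=
  Set.BijOn (fun c : ℕ × ℕ => T c.1 c.2) (μ.cells : Set (ℕ × ℕ)) (Set.Icc 1 μ.card)

/-- Standard tableaux of shape `μ`. -/
abbrev StandardTableau (μ : YoungDiagram) : Type :=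
  {T : SemistandardYoungTableau μ // IsStandard T}

/-- The descents of a standard tableau: the entries `i` such that `i + 1` lies in a row of
greater index. -/
def descents {μ : YoungDiagram} (U : StandardTableau μ) : Finset ℕ :=
  (entrySet U.1).filter fun i =>
    ∃ c ∈ μ.cells, ∃ d ∈ μ.cells, U.1 c.1 c.2 = i ∧ U.1 d.1 d.2 = i + 1 ∧ c.1 < d.1

/-- The vertices of the subcomponent of `B(μ)_n` associated to a standard tableau `U`: the
tableaux of `B(μ)_n` with the same minimal parsing as `U`. -/
def subcomponent {μ : YoungDiagram} (n : ℕ) (U : StandardTableau μ) :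
    Set (SemistandardYoungTableau μ) :=
  {T | T ∈ (crystal μ n).verts ∧ minimalParsing T = minimalParsing U.1}

/-- The labels of the edges of `B(μ)_n` from the subcomponent of `U` to the subcomponent
of `V`. -/
def linkLabels {μ : YoungDiagram} (n : ℕ) (U V : StandardTableau μ) : Set ℕ :=
  {i | ∃ T ∈ subcomponent n U, ∃ T' ∈ subcomponent n V, (crystal μ n).edge T i T'}

/-- The skeleton of `B(μ)_n`. Each subcomponent which occurs in `B(μ)_n` is replaced by its
standard tableau; there is one edge from `U` to a different `V` whenever some edge of `B(μ)_n`
goes from the subcomponent of `U` to that of `V`, and its label is the least label of such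
edges. -/
def skeleton (μ : YoungDiagram) (n : ℕ) : LabelledDigraph (StandardTableau μ) ℕ where
  verts := {U | (subcomponent n U).Nonempty}
  edge U i V := U ≠ V ∧ IsLeast (linkLabels n U V) i
  edge_mem := by
    rintro U i V ⟨-, ⟨T, hT, T', hT', -⟩, -⟩
    exact ⟨⟨T, hT⟩, ⟨T', hT'⟩⟩

/-!
The skeleton is controlled by standardization and by the band starts of a tableau.

A tableau `T` has the same minimal parsing as a standard tableau `U` exactly when `U` is the
standardization of `T` (`IsStandardization.minimalParsing_eq` and
`isStandardization_of_minimalParsing_eq`): inside a horizontal band the cells are ordered by their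
columns. The tableaux with standardization `U` are the fillings which
increase weakly along `U`, and strictly at the descents of `U`
(`IsStandard.exists_isStandardization`). Hence the subcomponent of `U` occurs in `B(μ)_n` if and
only if `n` is at least the number of bands of `U`, which is one more than the number of its
descents.

The operator `f_i` changes an `i` into `i + 1` in a cell `c` such that all the opening parentheses
read before `c`, and all the closing parentheses read after `c`, are coupled among themselves
(`crystalF_eq_some_iff`). If the edge from `T` to `T'` changes the standardization, the coupling
produces an entry `i` in a cell `x` and an entry `i + 1` in a cell `y` of a lower row, both
different from `c` (`CrystalMove.exists_splitMove`). So `i + 1` starts a band in `T` and in `T'`.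
The other band starts of `T` and `T'` agree, except that `i` may cease to be one, and that the least
entry greater than `i + 1` may become one. The position of `x` or `y` relative to `c` prevents both
from happening at once, so the two sets of band starts are nested
(`SplitMove.bandStarts_subset_or_subset`). In particular the numbers of bands, hence of descents,
differ by at most one.

Finally, replace each entry of `T` and of `T'` by its rank among the union of the two sets of band
starts. Standardizations are preserved, the largest entry is at most the larger number of bands, and
the result is again a crystal edge, with a label which is not greater (`CrystalMove.compress`):
entries merged with the letters `i` are read before `c`, and entries merged with the letters `i + 1`
are read after `c`, so that they do not disturb the coupling. Thus the least label of the edges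
between two subcomponents does not depend on the number of letters, as soon as both subcomponents
occur (`isLeast_linkLabels_iff`).
-/

/-! ### Parentheses in words -/

theorem uncoupledClosing_eq_nil_iff (i : ℕ) (w : List ℕ) (d p : ℕ) :
    uncoupledClosing i d p w = [] ↔ ∀ s, s <+: w → s.count i ≤ d + s.count (i + 1) := by
  induction w generalizing d p with
  | nil => simp [uncoupledClosing]
  | cons a w ih =>
    have key : (∀ s, s <+: a :: w → s.count i ≤ d + s.count (i + 1)) ↔
        ∀ s, s <+: w → (a :: s).count i ≤ d + (a :: s).count (i + 1) := by
      constructor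
      · exact fun h s hs => h _ (List.prefix_cons_iff.2 (Or.inr ⟨s, rfl, hs⟩))
      · intro h s hs
        rcases List.prefix_cons_iff.1 hs with rfl | ⟨t, rfl, ht⟩
        · simp
        · exact h t ht
    rw [key, uncoupledClosing]
    split_ifs with h1 h2 h3
    · subst h1
      rw [ih]
      refine forall₂_congr fun s _ => ?_
      rw [List.count_cons_self, List.count_cons_of_ne (by omega)]
      omega
    · subst h2 h3
      simp only [false_iff, not_forall]
      exact ⟨[], List.nil_prefix, by simp⟩
    · subst h2
      rw [ih]
      refine forall₂_congr fun s _ => ?_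
      rw [List.count_cons_self, List.count_cons_of_ne (by omega)]
      omega
    · rw [ih]
      refine forall₂_congr fun s _ => ?_
      rw [List.count_cons_of_ne h1, List.count_cons_of_ne h2]

/-- A word `l`, scanned with `d` opening parentheses already waiting, leaves none waiting. -/
def ClosesAll (i d : ℕ) (l : List ℕ) : Prop :=
  (∀ s, s <:+ l → s.count (i + 1) ≤ s.count i) ∧ d + l.count (i + 1) ≤ l.count i

theorem closesAll_cons_iff (i d a : ℕ) (l : List ℕ) :
    ClosesAll i d (a :: l) ↔
      ClosesAll i (if a = i + 1 then d + 1 else if a = i then d - 1 else d) l := by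
  have key : (∀ s, s <:+ a :: l → s.count (i + 1) ≤ s.count i) ↔
      (a :: l).count (i + 1) ≤ (a :: l).count i ∧
        ∀ s, s <:+ l → s.count (i + 1) ≤ s.count i := by
    simp only [List.suffix_cons_iff, or_imp, forall_and, forall_eq]
  have hl : (∀ s, s <:+ l → s.count (i + 1) ≤ s.count i) → l.count (i + 1) ≤ l.count i :=
    fun h => h l List.suffix_rfl
  rw [ClosesAll, ClosesAll, key]
  split_ifs with h1 h2
  · subst h1
    rw [List.count_cons_self, List.count_cons_of_ne (by omega)]
    constructor
    · rintro ⟨⟨-, h⟩, h'⟩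
      exact ⟨h, by omega⟩
    · rintro ⟨h, h'⟩
      exact ⟨⟨by omega, h⟩, by omega⟩
  · subst h2
    rw [List.count_cons_self, List.count_cons_of_ne (by omega)]
    constructor
    · rintro ⟨⟨-, h⟩, h'⟩
      have := hl h
      exact ⟨h, by omega⟩
    · rintro ⟨h, h'⟩
      exact ⟨⟨by omega, h⟩, by omega⟩
  · rw [List.count_cons_of_ne h1, List.count_cons_of_ne h2]
    exact ⟨fun h => ⟨h.1.2, h.2⟩, fun h => ⟨⟨hl h.1, h.1⟩, h.2⟩⟩

theorem exists_of_getLast?_uncoupledClosing {i q : ℕ} (w : List ℕ) (d p : ℕ)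
    (h : (uncoupledClosing i d p w).getLast? = some q) :
    ∃ l r, w = l ++ i :: r ∧ q = p + l.length ∧ ClosesAll i d l ∧
      ∀ s, s <+: r → s.count i ≤ s.count (i + 1) := by
  induction w generalizing d p with
  | nil => simp [uncoupledClosing] at h
  | cons a w ih =>
    have step : ∀ d', d' = (if a = i + 1 then d + 1 else if a = i then d - 1 else d) →
        (uncoupledClosing i d' (p + 1) w).getLast? = some q →
        ∃ l r, a :: w = l ++ i :: r ∧ q = p + l.length ∧ ClosesAll i d l ∧
          ∀ s, s <+: r → s.count i ≤ s.count (i + 1) := by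
      rintro d' hd' h'
      obtain ⟨l, r, rfl, rfl, hl, hr⟩ := ih _ _ h'
      refine ⟨a :: l, r, rfl, by simp; omega, ?_, hr⟩
      rw [closesAll_cons_iff, ← hd']
      exact hl
    rw [uncoupledClosing] at h
    split_ifs at h with h1 h2 h3
    · exact step _ (by simp [h1]) h
    · subst h2 h3
      by_cases hnil : uncoupledClosing a 0 (p + 1) w = []
      · rw [hnil] at h
        simp only [List.getLast?_singleton, Option.some.injEq] at h
        subst h
        refine ⟨[], w, rfl, rfl, ⟨by simp, by simp⟩, ?_⟩
        simpa using (uncoupledClosing_eq_nil_iff _ _ _ _).1 hnil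
      · refine step 0 (by simp) ?_
        rw [List.getLast?_cons] at h
        rw [List.getLast?_eq_some_getLast hnil] at h ⊢
        simpa using h
    · exact step _ (by simp [h2]) h
    · exact step _ (by simp [h1, h2]) h

theorem getLast?_uncoupledClosing {i : ℕ} (l r : List ℕ) (d p : ℕ) (hl : ClosesAll i d l)
    (hr : ∀ s, s <+: r → s.count i ≤ s.count (i + 1)) :
    (uncoupledClosing i d p (l ++ i :: r)).getLast? = some (p + l.length) := by
  induction l generalizing d p with
  | nil =>
    obtain rfl : d = 0 := by simpa using hl.2
    have : uncoupledClosing i 0 (p + 1) r = [] :=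
      (uncoupledClosing_eq_nil_iff _ _ _ _).2 (by simpa using hr)
    simp [uncoupledClosing, this]
  | cons a l ih =>
    rw [closesAll_cons_iff] at hl
    have := ih _ (p + 1) hl
    rw [List.cons_append, uncoupledClosing, List.length_cons,
      show p + (l.length + 1) = p + 1 + l.length by omega]
    split_ifs at this ⊢ with h1 h2 h3
    · exact this
    · subst h3
      rw [List.getLast?_cons]
      simp only [Nat.zero_sub] at this
      rw [this]
      rfl
    · exact this
    · exact this

/-- The operator `f_i` changes the letter `i` at the unique place such that all opening
parentheses before it and all closing parentheses after it are coupled among themselves. -/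
theorem crystalF_eq_some_iff {i : ℕ} {w w' : List ℕ} :
    crystalF i w = some w' ↔ ∃ l r, w = l ++ i :: r ∧ w' = l ++ (i + 1) :: r ∧
      (∀ s, s <:+ l → s.count (i + 1) ≤ s.count i) ∧
      ∀ s, s <+: r → s.count i ≤ s.count (i + 1) := by
  rw [crystalF, Option.map_eq_some_iff]
  constructor
  · rintro ⟨q, hq, rfl⟩
    obtain ⟨l, r, rfl, rfl, hl, hr⟩ := exists_of_getLast?_uncoupledClosing _ _ _ hq
    exact ⟨l, r, rfl, by simp, hl.1, hr⟩
  · rintro ⟨l, r, rfl, rfl, hl, hr⟩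
    refine ⟨_, getLast?_uncoupledClosing l r 0 0 ⟨hl, ?_⟩ hr, by simp⟩
    simpa using hl l List.suffix_rfl

/-! ### The row reading order -/

theorem mem_readingCells {μ : YoungDiagram} {c : ℕ × ℕ} : c ∈ readingCells μ ↔ c ∈ μ.cells := by
  obtain ⟨r, s⟩ := c
  simp only [readingCells, List.mem_flatMap, List.mem_reverse, List.mem_range, List.mem_map,
    Prod.mk.injEq, YoungDiagram.mem_cells]
  constructor
  · rintro ⟨_, -, _, h, rfl, rfl⟩
    exact YoungDiagram.mem_iff_lt_rowLen.2 h
  · intro h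
    exact ⟨r, YoungDiagram.mem_iff_lt_colLen.1 (μ.up_left_mem le_rfl (Nat.zero_le s) h), s,
      YoungDiagram.mem_iff_lt_rowLen.1 h, rfl, rfl⟩

/-- The cell `c` is read before the cell `d`: its row is lower, or it is on the left of `d` in
the same row. -/
def ReadBefore (c d : ℕ × ℕ) : Prop := d.1 < c.1 ∨ (c.1 = d.1 ∧ c.2 < d.2)

theorem pairwise_readingCells (μ : YoungDiagram) : (readingCells μ).Pairwise ReadBefore := by
  rw [readingCells, List.pairwise_flatMap]
  constructor
  · intro r _
    rw [List.pairwise_map]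
    exact List.pairwise_lt_range.imp fun h => Or.inr ⟨rfl, h⟩
  · rw [List.pairwise_reverse]
    refine List.pairwise_lt_range.imp fun h => ?_
    simp only [List.mem_map]
    rintro _ ⟨_, -, rfl⟩ _ ⟨_, -, rfl⟩
    exact Or.inl h

/-- The number of cells of a list in which `T` has the entry `v`. -/
def entryCount {μ : YoungDiagram} (T : SemistandardYoungTableau μ) (v : ℕ)
    (l : List (ℕ × ℕ)) : ℕ :=
  l.countP fun c => T c.1 c.2 = v

theorem count_map_eq_entryCount {μ : YoungDiagram} (T : SemistandardYoungTableau μ) (v : ℕ)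
    (l : List (ℕ × ℕ)) : (l.map fun c => T c.1 c.2).count v = entryCount T v l := by
  rw [List.count_eq_countP, List.countP_map, entryCount]
  congr 1

theorem entryCount_pos_iff {μ : YoungDiagram} {T : SemistandardYoungTableau μ} {v : ℕ}
    {l : List (ℕ × ℕ)} : 0 < entryCount T v l ↔ ∃ c ∈ l, T c.1 c.2 = v := by
  simp [entryCount, List.countP_pos_iff]

/-- `T'` is obtained from `T` by changing the entry `i` of the cell `c` into `i + 1`, where `c` is
the cell of the rightmost uncoupled closing parenthesis: `c` is read between the cells of `l` and
those of `r`, the opening parentheses in `l` are coupled inside `l`, and the closing ones in `r`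
are coupled inside `r`. -/
structure CrystalMove {μ : YoungDiagram} (i : ℕ) (T T' : SemistandardYoungTableau μ)
    (l : List (ℕ × ℕ)) (c : ℕ × ℕ) (r : List (ℕ × ℕ)) : Prop where
  cells_eq : readingCells μ = l ++ c :: r
  entry_eq : T c.1 c.2 = i
  entry_eq' : T' c.1 c.2 = i + 1
  entry_left : ∀ e ∈ l, T' e.1 e.2 = T e.1 e.2
  entry_right : ∀ e ∈ r, T' e.1 e.2 = T e.1 e.2
  suffix_le : ∀ s, s <:+ l → entryCount T (i + 1) s ≤ entryCount T i s
  prefix_le : ∀ s, s <+: r → entryCount T i s ≤ entryCount T (i + 1) s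

theorem crystalF_rowWord_iff {μ : YoungDiagram} {i : ℕ} {T T' : SemistandardYoungTableau μ} :
    crystalF i (rowWord T) = some (rowWord T') ↔ ∃ l c r, CrystalMove i T T' l c r := by
  rw [crystalF_eq_some_iff]
  constructor
  · rintro ⟨l, r, h, h', hl, hr⟩
    obtain ⟨l, r₁, hc, rfl, hr₁⟩ := List.map_eq_append_iff.1 h
    obtain ⟨c, r, rfl, rfl, rfl⟩ := List.map_eq_cons_iff.1 hr₁
    rw [rowWord, hc, List.map_append] at h'
    obtain ⟨h1, h2⟩ := List.append_inj h' (by simp)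
    rw [List.map_cons, List.cons.injEq] at h2
    refine ⟨l, c, r, hc, rfl, h2.1, List.map_inj_left.1 h1, List.map_inj_left.1 h2.2, ?_, ?_⟩
    · intro s hs
      simpa only [count_map_eq_entryCount] using hl _ (hs.map _)
    · intro s hs
      simpa only [count_map_eq_entryCount] using hr _ (hs.map _)
  · rintro ⟨l, c, r, h⟩
    refine ⟨l.map fun c => T c.1 c.2, r.map fun c => T c.1 c.2, ?_, ?_, ?_, ?_⟩
    · rw [rowWord, h.cells_eq, List.map_append, List.map_cons, h.entry_eq]
    · rw [rowWord, h.cells_eq, List.map_append, List.map_cons, h.entry_eq',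
        List.map_congr_left h.entry_left, List.map_congr_left h.entry_right]
    · intro s hs
      obtain ⟨t, ht, rfl⟩ := List.suffix_map_iff.1 hs
      simpa only [count_map_eq_entryCount] using h.suffix_le t ht
    · intro s hs
      obtain ⟨t, ht, rfl⟩ := List.prefix_map_iff.1 hs
      simpa only [count_map_eq_entryCount] using h.prefix_le t ht

/-! ### Positions of the entries of a tableau -/

namespace SemistandardYoungTableau

variable {μ : YoungDiagram} (T : SemistandardYoungTableau μ) {c d : ℕ × ℕ}

theorem apply_le_apply (h1 : c.1 ≤ d.1) (h2 : c.2 ≤ d.2) (hd : d ∈ μ.cells) :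
    T c.1 c.2 ≤ T d.1 d.2 := by
  have hd' : (d.1, d.2) ∈ μ := hd
  exact (T.row_weak_of_le h2 (μ.up_left_mem h1 le_rfl hd')).trans (T.col_weak h1 hd')

theorem apply_lt_apply (h1 : c.1 < d.1) (h2 : c.2 ≤ d.2) (hd : d ∈ μ.cells) :
    T c.1 c.2 < T d.1 d.2 := by
  have hd' : (d.1, d.2) ∈ μ := hd
  exact (T.row_weak_of_le h2 (μ.up_left_mem h1.le le_rfl hd')).trans_lt (T.col_strict h1 hd')

variable {T}

theorem eq_of_apply_eq (hc : c ∈ μ.cells) (hd : d ∈ μ.cells) (h : T c.1 c.2 = T d.1 d.2)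
    (h2 : c.2 = d.2) : c = d := by
  refine Prod.ext ?_ h2
  rcases lt_trichotomy c.1 d.1 with h1 | h1 | h1
  · exact absurd h (T.apply_lt_apply h1 h2.le hd).ne
  · exact h1
  · exact absurd h (T.apply_lt_apply h1 h2.ge hc).ne'

theorem row_le_of_apply_le (hd : d ∈ μ.cells) (h : T d.1 d.2 ≤ T c.1 c.2)
    (h2 : c.2 ≤ d.2) : d.1 ≤ c.1 := by
  by_contra! h1
  exact absurd (T.apply_lt_apply h1 h2 hd) h.not_gt

theorem mem_entrySet_of_mem (hc : c ∈ μ.cells) : T c.1 c.2 ∈ entrySet T :=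
  Finset.mem_image_of_mem (fun c : ℕ × ℕ => T c.1 c.2) hc

end SemistandardYoungTableau

open SemistandardYoungTableau

theorem mem_entrySet {μ : YoungDiagram} {T : SemistandardYoungTableau μ} {v : ℕ} :
    v ∈ entrySet T ↔ ∃ c ∈ μ.cells, T c.1 c.2 = v := by
  simp [entrySet]

/-! ### Horizontal bands -/

section Bands

variable {μ : YoungDiagram} {T : SemistandardYoungTableau μ}

theorem IsHorizontalBand.mono {a b a' b' : ℕ} (h : IsHorizontalBand T a b) (ha : a ≤ a')
    (hb : b' ≤ b) : IsHorizontalBand T a' b' :=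
  fun c hc d hd h1 h2 h3 => h c hc d hd (ha.trans h1) h2 (h3.trans hb)

theorem IsHorizontalBand.trans {a v b : ℕ} (h : IsHorizontalBand T a v)
    (h' : IsHorizontalBand T v b) (hv : v ∈ entrySet T) : IsHorizontalBand T a b := by
  intro c hc d hd h1 h2 h3
  rcases le_or_gt (T d.1 d.2) v with hdv | hdv
  · exact h c hc d hd h1 h2 hdv
  rcases le_or_gt v (T c.1 c.2) with hcv | hcv
  · exact h' c hc d hd hcv h2 h3
  obtain ⟨e, he, rfl⟩ := mem_entrySet.1 hv
  have := h c hc e he h1 hcv le_rfl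
  have := h' e he d hd le_rfl hdv h3
  omega

theorem mem_bandStarts {v : ℕ} : v ∈ bandStarts T ↔
    v ∈ entrySet T ∧ ∀ u ∈ entrySet T, u < v → ¬ IsHorizontalBand T u v := by
  simp [bandStarts]

theorem exists_isHorizontalBand_of_notMem_bandStarts {v : ℕ} (hv : v ∈ entrySet T)
    (h : v ∉ bandStarts T) : ∃ u ∈ entrySet T, u < v ∧ IsHorizontalBand T u v := by
  by_contra! hcon
  exact h (mem_bandStarts.2 ⟨hv, hcon⟩)

/-- If `v` starts no band, a smaller entry that can be joined to `v` may be taken at least equal to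
any prescribed smaller entry `u`. -/
theorem exists_isHorizontalBand_ge {u v : ℕ} (hu : u ∈ entrySet T) (hv : v ∈ entrySet T)
    (huv : u < v) (h : v ∉ bandStarts T) :
    ∃ w ∈ entrySet T, u ≤ w ∧ w < v ∧ IsHorizontalBand T w v := by
  obtain ⟨w, hw, hwv, hb⟩ := exists_isHorizontalBand_of_notMem_bandStarts hv h
  rcases le_total u w with huw | huw
  · exact ⟨w, hw, huw, hwv, hb⟩
  · exact ⟨u, hu, le_rfl, huv, hb.mono huw le_rfl⟩

theorem isHorizontalBand_of_forall_notMem {u v : ℕ} (hu : u ∈ entrySet T) (hv : v ∈ entrySet T)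
    (huv : u ≤ v) (h : ∀ w, u < w → w ≤ v → w ∉ bandStarts T) : IsHorizontalBand T u v := by
  induction v using Nat.strong_induction_on with
  | _ v ih =>
    rcases huv.eq_or_lt with rfl | huv
    · intro c _ d _ h1 h2 h3
      omega
    obtain ⟨w, hw, huw, hwv, hb⟩ := exists_isHorizontalBand_ge hu hv huv (h v huv le_rfl)
    exact (ih w hwv hw huw fun x hx hxw => h x hx (hxw.trans hwv.le)).trans hb hw

theorem bandIndex_mono {c d : ℕ × ℕ} (h : T c.1 c.2 ≤ T d.1 d.2) :
    bandIndex T c ≤ bandIndex T d :=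
  Finset.card_le_card (Finset.monotone_filter_right _ fun _ _ hv => hv.trans h)

theorem bandIndex_eq_imp {c d : ℕ × ℕ} (hc : c ∈ μ.cells) (hd : d ∈ μ.cells)
    (h : bandIndex T c = bandIndex T d) (hlt : T c.1 c.2 < T d.1 d.2) :
    d.1 ≤ c.1 ∧ c.2 < d.2 := by
  have hsub : (bandStarts T).filter (fun v => v ≤ T c.1 c.2) ⊆
      (bandStarts T).filter (fun v => v ≤ T d.1 d.2) :=
    Finset.monotone_filter_right _ fun _ _ hv => hv.trans hlt.le
  have heq := Finset.eq_of_subset_of_card_le hsub h.ge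
  refine isHorizontalBand_of_forall_notMem (mem_entrySet_of_mem hc) (mem_entrySet_of_mem hd)
    hlt.le (fun w hw hwd hmem => ?_) c hc d hd le_rfl hlt le_rfl
  have : w ∈ (bandStarts T).filter (fun v => v ≤ T c.1 c.2) := by
    rw [heq]
    exact Finset.mem_filter.2 ⟨hmem, hwd⟩
  have := (Finset.mem_filter.1 this).2
  omega

theorem bandIndex_le_card (c : ℕ × ℕ) : bandIndex T c ≤ (bandStarts T).card :=
  Finset.card_filter_le _ _

theorem exists_bandStart_le {v : ℕ} (hv : v ∈ entrySet T) : ∃ u ∈ bandStarts T, u ≤ v := by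
  induction v using Nat.strong_induction_on with
  | _ v ih =>
    by_cases h : v ∈ bandStarts T
    · exact ⟨v, h, le_rfl⟩
    · obtain ⟨w, hw, hwv, -⟩ := exists_isHorizontalBand_of_notMem_bandStarts hv h
      obtain ⟨u, hu, huw⟩ := ih w hwv hw
      exact ⟨u, hu, huw.trans hwv.le⟩

theorem bandIndex_pos {c : ℕ × ℕ} (hc : c ∈ μ.cells) : 1 ≤ bandIndex T c := by
  obtain ⟨u, hu, huc⟩ := exists_bandStart_le (mem_entrySet_of_mem (T := T) hc)
  exact Finset.card_pos.2 ⟨u, Finset.mem_filter.2 ⟨hu, huc⟩⟩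

theorem length_minimalParsing : (minimalParsing T).length = (bandStarts T).card := by
  simp [minimalParsing]

theorem length_descentComposition : (descentComposition T).length = (bandStarts T).card := by
  simp [descentComposition, length_minimalParsing]

theorem minimalParsing_eq_iff {T' : SemistandardYoungTableau μ} :
    minimalParsing T = minimalParsing T' ↔
      (bandStarts T).card = (bandStarts T').card ∧
        ∀ c ∈ μ.cells, bandIndex T c = bandIndex T' c := by
  constructor
  · intro h
    have hcard : (bandStarts T).card = (bandStarts T').card := by
      rw [← length_minimalParsing, ← length_minimalParsing, h]
    refine ⟨hcard, fun c hc => ?_⟩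
    have h1 := bandIndex_pos (T := T) hc
    have h2 := bandIndex_le_card (T := T) c
    rw [minimalParsing, minimalParsing, ← hcard, List.map_inj_left] at h
    have h3 := h (bandIndex T c - 1) (List.mem_range.2 (by omega))
    have h4 : c ∈ μ.cells.filter fun c' => bandIndex T c' = bandIndex T c - 1 + 1 :=
      Finset.mem_filter.2 ⟨hc, by omega⟩
    rw [h3, Finset.mem_filter] at h4
    omega
  · rintro ⟨hcard, h⟩
    rw [minimalParsing, minimalParsing, hcard]
    refine List.map_congr_left fun k _ => Finset.filter_congr fun c hc => ?_
    rw [h c hc]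

end Bands

/-! ### Standardization -/

section Standardization

variable {μ : YoungDiagram}

/-- The order of the entries of `U` is the order of the entries of `T`, with equal entries
compared from left to right. For a standard tableau `U` this means that `U` is the
standardization of `T`. -/
def IsStandardization (T U : SemistandardYoungTableau μ) : Prop :=
  ∀ c ∈ μ.cells, ∀ d ∈ μ.cells,
    U c.1 c.2 < U d.1 d.2 ↔ T c.1 c.2 < T d.1 d.2 ∨ (T c.1 c.2 = T d.1 d.2 ∧ c.2 < d.2)

variable {T U : SemistandardYoungTableau μ}

theorem IsStandard.eq_of_apply_eq (hU : IsStandard U) {c d : ℕ × ℕ} (hc : c ∈ μ.cells)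
    (hd : d ∈ μ.cells) (h : U c.1 c.2 = U d.1 d.2) : c = d :=
  Set.BijOn.injOn hU (Finset.mem_coe.2 hc) (Finset.mem_coe.2 hd) h

theorem IsStandard.isStandardization_self (hU : IsStandard U) : IsStandardization U U := by
  intro c hc d hd
  refine ⟨Or.inl, ?_⟩
  rintro (h | ⟨h, h2⟩)
  · exact h
  · rw [hU.eq_of_apply_eq hc hd h] at h2
    omega

theorem IsStandardization.le (h : IsStandardization T U) {c d : ℕ × ℕ} (hc : c ∈ μ.cells)
    (hd : d ∈ μ.cells) (hcd : U c.1 c.2 < U d.1 d.2) : T c.1 c.2 ≤ T d.1 d.2 := by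
  rcases (h c hc d hd).1 hcd with h | h
  · exact h.le
  · exact h.1.le

theorem IsStandardization.northEast (h : IsStandardization T U) {c d : ℕ × ℕ}
    (hc : c ∈ μ.cells) (hd : d ∈ μ.cells) (hcd : U c.1 c.2 < U d.1 d.2)
    (heq : T c.1 c.2 = T d.1 d.2) : d.1 ≤ c.1 ∧ c.2 < d.2 := by
  have h2 : c.2 < d.2 := by
    rcases (h c hc d hd).1 hcd with h | h
    · exact absurd heq h.ne
    · exact h.2
  exact ⟨row_le_of_apply_le hd heq.ge h2.le, h2⟩

/-- The cells which come first in their maximal horizontal band. -/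
def breakCells (T : SemistandardYoungTableau μ) : Finset (ℕ × ℕ) :=
  μ.cells.filter fun e => T e.1 e.2 ∈ bandStarts T ∧
    ∀ d ∈ μ.cells, T d.1 d.2 = T e.1 e.2 → e.2 ≤ d.2

theorem exists_mem_breakCells {v : ℕ} (hv : v ∈ bandStarts T) :
    ∃ e ∈ breakCells T, T e.1 e.2 = v := by
  obtain ⟨c, hc, hcv⟩ := mem_entrySet.1 (mem_bandStarts.1 hv).1
  obtain ⟨e, he, hmin⟩ := (μ.cells.filter fun e => T e.1 e.2 = v).exists_min_image Prod.snd
    ⟨c, Finset.mem_filter.2 ⟨hc, hcv⟩⟩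
  rw [Finset.mem_filter] at he
  refine ⟨e, Finset.mem_filter.2 ⟨he.1, he.2 ▸ hv, fun d hd hde => ?_⟩, he.2⟩
  exact hmin d (Finset.mem_filter.2 ⟨hd, hde.trans he.2⟩)

theorem card_filter_breakCells (p : ℕ → Prop) [DecidablePred p] :
    ((breakCells T).filter fun e => p (T e.1 e.2)).card = ((bandStarts T).filter p).card := by
  refine Finset.card_bij (fun e _ => T e.1 e.2) ?_ ?_ ?_
  · intro e he
    simp only [breakCells, Finset.mem_filter] at he ⊢
    exact ⟨he.1.2.1, he.2⟩
  · intro e he d hd hed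
    simp only [breakCells, Finset.mem_filter] at he hd
    exact eq_of_apply_eq he.1.1 hd.1.1 hed
      (le_antisymm (he.1.2.2 d hd.1.1 hed.symm) (hd.1.2.2 e he.1.1 hed))
  · intro v hv
    obtain ⟨e, he, rfl⟩ := exists_mem_breakCells (Finset.mem_filter.1 hv).1
    exact ⟨e, Finset.mem_filter.2 ⟨he, (Finset.mem_filter.1 hv).2⟩, rfl⟩

/-- The first cells of the maximal horizontal bands depend only on the standardization. -/
theorem IsStandardization.mem_breakCells_iff (h : IsStandardization T U) (hU : IsStandard U)
    {e : ℕ × ℕ} (he : e ∈ μ.cells) :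
    e ∈ breakCells T ↔ U e.1 e.2 ∈ bandStarts U := by
  rw [mem_bandStarts]
  simp only [mem_entrySet_of_mem he, true_and, breakCells, Finset.mem_filter, he]
  constructor
  · rintro ⟨hstart, hleft⟩ u hu hue hband
    obtain ⟨c, hc, rfl⟩ := mem_entrySet.1 hu
    have hlt : T c.1 c.2 < T e.1 e.2 := by
      rcases (h c hc e he).1 hue with h1 | ⟨h1, h2⟩
      · exact h1
      · exact absurd (hleft c hc h1) h2.not_ge
    refine (mem_bandStarts.1 hstart).2 _ (mem_entrySet_of_mem hc) hlt ?_
    intro x hx y hy h1 h2 h3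
    have hxy : U x.1 x.2 < U y.1 y.2 := (h x hx y hy).2 (Or.inl h2)
    -- Cells with the entry of `c` before `c`, or with the entry of `e` after `e`, are
    -- compared with `c` or `e` by semistandardness.
    have hcx : ∃ x' ∈ μ.cells, U c.1 c.2 ≤ U x'.1 x'.2 ∧ x'.1 ≤ x.1 ∧ x.2 ≤ x'.2 ∧
        T x'.1 x'.2 = T x.1 x.2 := by
      rcases le_or_gt (U c.1 c.2) (U x.1 x.2) with hle | hgt
      · exact ⟨x, hx, hle, le_rfl, le_rfl, rfl⟩
      · have heq := le_antisymm (h.le hx hc hgt) h1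
        have := h.northEast hx hc hgt heq
        exact ⟨c, hc, le_rfl, this.1, this.2.le, heq.symm⟩
    have hye : ∃ y' ∈ μ.cells, U y'.1 y'.2 ≤ U e.1 e.2 ∧ y.1 ≤ y'.1 ∧ y'.2 ≤ y.2 ∧
        T y'.1 y'.2 = T y.1 y.2 := by
      rcases le_or_gt (U y.1 y.2) (U e.1 e.2) with hle | hgt
      · exact ⟨y, hy, hle, le_rfl, le_rfl, rfl⟩
      · have heq := le_antisymm (h.le he hy hgt) h3
        have := h.northEast he hy hgt heq
        exact ⟨e, he, le_rfl, this.1, this.2.le, heq⟩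
    obtain ⟨x', hx', hcx, hx1, hx2, hx3⟩ := hcx
    obtain ⟨y', hy', hye, hy1, hy2, hy3⟩ := hye
    have := hband x' hx' y' hy' hcx ((h x' hx' y' hy').2 (Or.inl (by omega))) hye
    omega
  · intro hstart
    refine ⟨mem_bandStarts.2 ⟨mem_entrySet_of_mem he, fun u hu hue hband => ?_⟩,
      fun d hd hde => ?_⟩
    · obtain ⟨c, hc, rfl⟩ := mem_entrySet.1 hu
      refine hstart _ (mem_entrySet_of_mem hc) ((h c hc e he).2 (Or.inl hue)) ?_
      intro x hx y hy h1 h2 h3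
      have hcx : T c.1 c.2 ≤ T x.1 x.2 := by
        rcases h1.eq_or_lt with h1 | h1
        · rw [hU.eq_of_apply_eq hc hx h1]
        · exact h.le hc hx h1
      have hye : T y.1 y.2 ≤ T e.1 e.2 := by
        rcases h3.eq_or_lt with h3 | h3
        · rw [hU.eq_of_apply_eq hy he h3]
        · exact h.le hy he h3
      rcases (h.le hx hy h2).eq_or_lt with heq | hlt
      · exact h.northEast hx hy h2 heq
      · exact hband x hx y hy hcx hlt hye
    · by_contra! hlt
      have hde' : U d.1 d.2 < U e.1 e.2 := (h d hd e he).2 (Or.inr ⟨hde, hlt⟩)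
      refine hstart _ (mem_entrySet_of_mem hd) hde' ?_
      intro x hx y hy h1 h2 h3
      have hdx : T d.1 d.2 ≤ T x.1 x.2 := by
        rcases h1.eq_or_lt with h1 | h1
        · rw [hU.eq_of_apply_eq hd hx h1]
        · exact h.le hd hx h1
      have hye : T y.1 y.2 ≤ T e.1 e.2 := by
        rcases h3.eq_or_lt with h3 | h3
        · rw [hU.eq_of_apply_eq hy he h3]
        · exact h.le hy he h3
      have hxy := h.le hx hy h2
      exact h.northEast hx hy h2 (by omega)

theorem IsStandardization.minimalParsing_eq (h : IsStandardization T U) (hU : IsStandard U) :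
    minimalParsing T = minimalParsing U := by
  have hbreak : breakCells T = breakCells U := by
    ext e
    by_cases he : e ∈ μ.cells
    · rw [h.mem_breakCells_iff hU he, hU.isStandardization_self.mem_breakCells_iff hU he]
    · simp [breakCells, he]
  rw [minimalParsing_eq_iff]
  constructor
  · have h1 := card_filter_breakCells (T := T) fun _ => True
    have h2 := card_filter_breakCells (T := U) fun _ => True
    simp only [Finset.filter_true] at h1 h2
    rw [← h1, ← h2, hbreak]
  · intro c hc
    rw [bandIndex, bandIndex, ← card_filter_breakCells, ← card_filter_breakCells, hbreak]
    congr 1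
    refine Finset.filter_congr fun e he => ?_
    have heT := he
    rw [← hbreak, breakCells, Finset.mem_filter] at heT
    rw [← not_lt, ← not_lt, h c hc e heT.1]
    refine not_congr ⟨Or.inl, ?_⟩
    rintro (h1 | ⟨h1, h2⟩)
    · exact h1
    · exact absurd (heT.2.2 c hc h1) h2.not_ge

theorem isStandardization_of_minimalParsing_eq (hU : IsStandard U)
    (h : minimalParsing T = minimalParsing U) : IsStandardization T U := by
  obtain ⟨-, h⟩ := minimalParsing_eq_iff.1 h
  intro c hc d hd
  have key : ∀ S : SemistandardYoungTableau μ,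
      (S c.1 c.2 < S d.1 d.2 ∨ (S c.1 c.2 = S d.1 d.2 ∧ c.2 < d.2)) ↔
        bandIndex S c < bandIndex S d ∨ (bandIndex S c = bandIndex S d ∧ c.2 < d.2) := by
    intro S
    rcases lt_trichotomy (S c.1 c.2) (S d.1 d.2) with hlt | heq | hgt
    · have h1 := bandIndex_mono hlt.le
      have h2 := fun h => bandIndex_eq_imp hc hd h hlt
      constructor
      · intro _
        rcases h1.lt_or_eq with h1 | h1
        · exact Or.inl h1
        · exact Or.inr ⟨h1, (h2 h1).2⟩
      · exact fun _ => Or.inl hlt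
    · have : bandIndex S c = bandIndex S d :=
        le_antisymm (bandIndex_mono heq.le) (bandIndex_mono heq.ge)
      simp [heq, this]
    · have h1 := bandIndex_mono hgt.le
      have h2 := fun h => bandIndex_eq_imp hd hc h hgt
      constructor
      · omega
      · rintro (h3 | ⟨h3, h4⟩)
        · omega
        · have := h2 h3.symm
          omega
  rw [hU.isStandardization_self c hc d hd, key, key T, h c hc, h d hd]

theorem IsStandard.apply_eq_card (hU : IsStandard U) {c : ℕ × ℕ} (hc : c ∈ μ.cells) :
    U c.1 c.2 = (μ.cells.filter fun d => ¬ U c.1 c.2 < U d.1 d.2).card := by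
  have himg : (μ.cells.filter fun d => ¬ U c.1 c.2 < U d.1 d.2).image (fun d => U d.1 d.2) =
      Finset.Icc 1 (U c.1 c.2) := by
    ext v
    simp only [Finset.mem_image, Finset.mem_filter, Finset.mem_Icc, not_lt]
    constructor
    · rintro ⟨d, ⟨hd, hdc⟩, rfl⟩
      exact ⟨(hU.mapsTo (Finset.mem_coe.2 hd)).1, hdc⟩
    · rintro ⟨h1, h2⟩
      have h3 : U c.1 c.2 ≤ μ.card := (hU.mapsTo (Finset.mem_coe.2 hc)).2
      obtain ⟨d, hd, rfl⟩ := hU.surjOn (⟨h1, h2.trans h3⟩ : v ∈ Set.Icc 1 μ.card)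
      exact ⟨d, ⟨hd, h2⟩, rfl⟩
  rw [← Finset.card_image_of_injOn (f := fun d : ℕ × ℕ => U d.1 d.2), himg, Nat.card_Icc]
  · omega
  · intro x hx y hy hxy
    simp only [Finset.coe_filter, Set.mem_ofPred_eq] at hx hy
    exact hU.eq_of_apply_eq hx.1 hy.1 hxy

theorem IsStandard.eq_of_lt_iff {V : SemistandardYoungTableau μ} (hU : IsStandard U)
    (hV : IsStandard V)
    (h : ∀ c ∈ μ.cells, ∀ d ∈ μ.cells, U c.1 c.2 < U d.1 d.2 ↔ V c.1 c.2 < V d.1 d.2) :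
    U = V := by
  refine SemistandardYoungTableau.ext fun a b => ?_
  by_cases hc : (a, b) ∈ μ
  · have h1 := hU.apply_eq_card (c := (a, b)) hc
    have h2 := hV.apply_eq_card (c := (a, b)) hc
    refine h1.trans (Eq.trans ?_ h2.symm)
    congr 1
    exact Finset.filter_congr fun d hd => not_congr (h _ hc d hd)
  · rw [U.zeros hc, V.zeros hc]

/-- A filling which increases weakly along the order of the entries of a standard tableau `U`, and
strictly between cells which are not in North-East position, is a semistandard tableau with
standardization `U`. -/
theorem IsStandard.exists_isStandardization (hU : IsStandard U) (g : ℕ × ℕ → ℕ)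
    (hg : ∀ c ∈ μ.cells, ∀ d ∈ μ.cells, U c.1 c.2 < U d.1 d.2 →
      g c ≤ g d ∧ (g c = g d → d.1 ≤ c.1 ∧ c.2 < d.2)) :
    ∃ S : SemistandardYoungTableau μ, (∀ c ∈ μ.cells, S c.1 c.2 = g c) ∧
      IsStandardization S U := by
  let S : SemistandardYoungTableau μ :=
    { entry := fun a b => if (a, b) ∈ μ then g (a, b) else 0
      row_weak' := by
        intro i j₁ j₂ hj h
        have h' : (i, j₁) ∈ μ := μ.up_left_mem le_rfl hj.le h
        simp only [h, h', if_true]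
        have hle : U i j₁ ≤ U i j₂ := U.row_weak hj h
        have hne : U i j₁ ≠ U i j₂ := fun heq => by
          have := hU.eq_of_apply_eq (c := (i, j₁)) (d := (i, j₂)) h' h heq
          simp only [Prod.mk.injEq, true_and] at this
          omega
        exact (hg (i, j₁) h' (i, j₂) h (lt_of_le_of_ne hle hne)).1
      col_strict' := by
        intro i₁ i₂ j hi h
        have h' : (i₁, j) ∈ μ := μ.up_left_mem hi.le le_rfl h
        simp only [h, h', if_true]
        have := hg (i₁, j) h' (i₂, j) h (U.col_strict hi h)
        exact lt_of_le_of_ne this.1 fun heq => absurd (this.2 heq).2 (lt_irrefl _)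
      zeros' := by
        intro i j h
        simp [h] }
  have hS : ∀ c ∈ μ.cells, S c.1 c.2 = g c := fun c hc => if_pos hc
  refine ⟨S, hS, fun c hc d hd => ?_⟩
  rw [hS c hc, hS d hd]
  constructor
  · intro hlt
    have := hg c hc d hd hlt
    rcases this.1.lt_or_eq with h | h
    · exact Or.inl h
    · exact Or.inr ⟨h, (this.2 h).2⟩
  · intro h
    by_contra! hle
    rcases hle.lt_or_eq with hlt | heq
    · have := hg d hd c hc hlt
      rcases h with h | h
      · omega
      · have := this.2 h.1.symm
        omega
    · obtain rfl := hU.eq_of_apply_eq hd hc heq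
      omega

end Standardization

/-! ### Band starts and descents of standard tableaux -/

section Descents

variable {μ : YoungDiagram}

theorem succ_mem_bandStarts {T : SemistandardYoungTableau μ} {i : ℕ} {x y : ℕ × ℕ}
    (hx : x ∈ μ.cells) (hy : y ∈ μ.cells) (hxi : T x.1 x.2 = i) (hyi : T y.1 y.2 = i + 1)
    (hxy : x.1 < y.1) : i + 1 ∈ bandStarts T := by
  refine mem_bandStarts.2 ⟨hyi ▸ mem_entrySet_of_mem hy, fun u _ hu hband => ?_⟩
  have := hband x hx y hy (by omega) (by omega) hyi.le
  omega

theorem IsStandard.mem_entrySet_iff {U : SemistandardYoungTableau μ} (hU : IsStandard U) {v : ℕ} :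
    v ∈ entrySet U ↔ 1 ≤ v ∧ v ≤ μ.card := by
  rw [mem_entrySet]
  constructor
  · rintro ⟨c, hc, rfl⟩
    exact hU.mapsTo (Finset.mem_coe.2 hc)
  · intro h
    obtain ⟨c, hc, hcv⟩ := hU.surjOn (show v ∈ Set.Icc 1 μ.card from h)
    exact ⟨c, hc, hcv⟩

theorem bandStarts_eq_insert (U : StandardTableau μ) (h : μ.cells.Nonempty) :
    bandStarts U.1 = insert 1 ((descents U).image fun i => i + 1) := by
  ext v
  simp only [Finset.mem_insert, Finset.mem_image, descents, Finset.mem_filter]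
  constructor
  · intro hv
    have hv' := (U.2.mem_entrySet_iff).1 (mem_bandStarts.1 hv).1
    rcases hv'.1.eq_or_lt with h1 | h1
    · exact Or.inl h1.symm
    right
    have hpred : v - 1 ∈ entrySet U.1 := U.2.mem_entrySet_iff.2 (by omega)
    refine ⟨v - 1, ⟨hpred, ?_⟩, by omega⟩
    have hband := (mem_bandStarts.1 hv).2 _ hpred (by omega)
    simp only [IsHorizontalBand, not_forall] at hband
    obtain ⟨x, hx, y, hy, h1, h2, h3, h4⟩ := hband
    refine ⟨x, hx, y, hy, by omega, by omega, ?_⟩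
    by_contra! hle
    have := U.1.apply_le_apply hle (by omega) hx
    omega
  · rintro (rfl | ⟨i, ⟨-, x, hx, y, hy, hxi, hyi, hxy⟩, rfl⟩)
    · refine mem_bandStarts.2 ⟨U.2.mem_entrySet_iff.2 ⟨le_rfl, Finset.card_pos.2 h⟩, ?_⟩
      intro u hu hu1
      have := (U.2.mem_entrySet_iff.1 hu).1
      omega
    · exact succ_mem_bandStarts hx hy hxi hyi hxy

theorem card_bandStarts_eq_card_descents_add_one (U : StandardTableau μ) (h : μ.cells.Nonempty) :
    (bandStarts U.1).card = (descents U).card + 1 := by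
  rw [bandStarts_eq_insert U h, Finset.card_insert_of_notMem,
    Finset.card_image_of_injective _ (add_left_injective 1)]
  simp only [Finset.mem_image, descents, Finset.mem_filter, not_exists, not_and]
  intro i hi
  have := (U.2.mem_entrySet_iff.1 hi.1).1
  omega

end Descents

/-! ### Crystal edges between different subcomponents -/

namespace CrystalMove

variable {μ : YoungDiagram} {i : ℕ} {T T' : SemistandardYoungTableau μ} {l r : List (ℕ × ℕ)}
  {c : ℕ × ℕ}

theorem mem_iff (h : CrystalMove i T T' l c r) {e : ℕ × ℕ} :
    e ∈ μ.cells ↔ e ∈ l ∨ e = c ∨ e ∈ r := by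
  rw [← mem_readingCells, h.cells_eq]
  simp

theorem mem (h : CrystalMove i T T' l c r) : c ∈ μ.cells := h.mem_iff.2 (Or.inr (Or.inl rfl))

theorem apply_eq (h : CrystalMove i T T' l c r) {e : ℕ × ℕ} (he : e ∈ μ.cells) (hne : e ≠ c) :
    T' e.1 e.2 = T e.1 e.2 := by
  rcases h.mem_iff.1 he with h1 | h1 | h1
  · exact h.entry_left e h1
  · exact absurd h1 hne
  · exact h.entry_right e h1

theorem pairwise (h : CrystalMove i T T' l c r) :
    l.Pairwise ReadBefore ∧ r.Pairwise ReadBefore ∧ (∀ e ∈ l, ReadBefore e c) ∧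
      ∀ e ∈ r, ReadBefore c e := by
  have hp := pairwise_readingCells μ
  rw [h.cells_eq, List.pairwise_append, List.pairwise_cons] at hp
  exact ⟨hp.1, hp.2.1.2, fun e he => hp.2.2 e he c (by simp), hp.2.1.1⟩

end CrystalMove

/-- `T'` is obtained from `T` by changing the entry `i` of the cell `c` into `i + 1`, and both
tableaux have in common an `i` in the cell `x` and an `i + 1` in a lower row, in the cell `y`.
Moreover `c` is on the South-West of `y` or on the North-East of `x`. -/
structure SplitMove {μ : YoungDiagram} (i : ℕ) (T T' : SemistandardYoungTableau μ)
    (c x y : ℕ × ℕ) : Prop where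
  mem : c ∈ μ.cells
  mem_x : x ∈ μ.cells
  mem_y : y ∈ μ.cells
  entry_eq : T c.1 c.2 = i
  entry_eq' : T' c.1 c.2 = i + 1
  apply_eq : ∀ e ∈ μ.cells, e ≠ c → T' e.1 e.2 = T e.1 e.2
  x_ne : x ≠ c
  y_ne : y ≠ c
  entry_x : T x.1 x.2 = i
  entry_y : T y.1 y.2 = i + 1
  row_lt : x.1 < y.1
  position : (y.1 ≤ c.1 ∧ c.2 < y.2) ∨ (c.1 ≤ x.1 ∧ x.2 < c.2)

/-- A crystal edge which changes the standardization leaves letters `i` and `i + 1` in descent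
position: if some `i` is read after the changed cell, it is coupled with an `i + 1` read between
them; otherwise the standardization can only change if some `i + 1` lies on the left of the
changed cell, and this `i + 1` is coupled with an `i` read between them. -/
theorem CrystalMove.exists_splitMove {μ : YoungDiagram} {i : ℕ}
    {T T' U V : SemistandardYoungTableau μ} {l r : List (ℕ × ℕ)} {c : ℕ × ℕ}
    (h : CrystalMove i T T' l c r) (hU : IsStandard U) (hV : IsStandard V)
    (hTU : IsStandardization T U) (hTV : IsStandardization T' V) (hne : U ≠ V) :
    ∃ x y, SplitMove i T T' c x y := by
  obtain ⟨hpl, hpr, hl, hr⟩ := h.pairwise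
  have hnel : ∀ e ∈ l, e ≠ c := by
    rintro e he rfl
    have := hl e he
    simp only [ReadBefore] at this
    omega
  have hner : ∀ e ∈ r, e ≠ c := by
    rintro e he rfl
    have := hr e he
    simp only [ReadBefore] at this
    omega
  have hml : ∀ e ∈ l, e ∈ μ.cells := fun e he => h.mem_iff.2 (Or.inl he)
  have hmr : ∀ e ∈ r, e ∈ μ.cells := fun e he => h.mem_iff.2 (Or.inr (Or.inr he))
  by_cases hA : ∃ x ∈ r, T x.1 x.2 = i
  · obtain ⟨x, hx, hxi⟩ := hA
    obtain ⟨r₁, r₂, rfl⟩ := List.append_of_mem hx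
    have hle := h.prefix_le (r₁ ++ [x]) ⟨r₂, by simp⟩
    have hpos : 0 < entryCount T i (r₁ ++ [x]) := entryCount_pos_iff.2 ⟨x, by simp, hxi⟩
    obtain ⟨y, hy, hyi⟩ := entryCount_pos_iff.1 (hpos.trans_le hle)
    have hy₁ : y ∈ r₁ := by
      rcases List.mem_append.1 hy with hy | hy
      · exact hy
      · rw [List.mem_singleton.1 hy] at hyi
        omega
    have hyr : y ∈ r₁ ++ x :: r₂ := List.mem_append_left _ hy₁
    have hyx : ReadBefore y x := (List.pairwise_append.1 hpr).2.2 y hy₁ x (by simp)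
    have hcy := hr y hyr
    simp only [ReadBefore] at hyx hcy
    have hxm := hmr x hx
    have hym := hmr y hyr
    have hci := h.entry_eq
    refine ⟨x, y, h.mem, hxm, hym, h.entry_eq, h.entry_eq', fun e => h.apply_eq, hner x hx,
      hner y hyr, hxi, hyi, ?_, Or.inl ?_⟩
    · by_contra! hle
      have := T.apply_le_apply (c := y) (d := x) (by omega) (by omega) hxm
      omega
    · refine ⟨by omega, ?_⟩
      by_contra! hle
      have := T.apply_le_apply (c := y) (d := c) (by omega) (by omega) h.mem
      omega
  by_cases hB : ∃ y ∈ μ.cells, T y.1 y.2 = i + 1 ∧ y.2 < c.2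
  · obtain ⟨y, hym, hyi, hyc⟩ := hB
    have hci := h.entry_eq
    have hrow : c.1 < y.1 := by
      by_contra! hle
      have := T.apply_le_apply hle hyc.le h.mem
      omega
    have hyl : y ∈ l := by
      rcases h.mem_iff.1 hym with h1 | rfl | h1
      · exact h1
      · omega
      · have := hr y h1
        simp only [ReadBefore] at this
        omega
    obtain ⟨l₁, l₂, rfl⟩ := List.append_of_mem hyl
    have hle := h.suffix_le (y :: l₂) ⟨l₁, rfl⟩
    have hpos : 0 < entryCount T (i + 1) (y :: l₂) := entryCount_pos_iff.2 ⟨y, by simp, hyi⟩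
    obtain ⟨x, hx, hxi⟩ := entryCount_pos_iff.1 (hpos.trans_le hle)
    have hx₂ : x ∈ l₂ := by
      rcases List.mem_cons.1 hx with rfl | hx
      · omega
      · exact hx
    have hxl : x ∈ l₁ ++ y :: l₂ := List.mem_append_right _ (List.mem_cons_of_mem _ hx₂)
    have hyx : ReadBefore y x :=
      (List.pairwise_cons.1 (List.pairwise_append.1 hpl).2.1).1 x hx₂
    have hxc := hl x hxl
    simp only [ReadBefore] at hyx hxc
    have hxm := hml x hxl
    refine ⟨x, y, h.mem, hxm, hym, h.entry_eq, h.entry_eq', fun e => h.apply_eq, hnel x hxl,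
      hnel y hyl, hxi, hyi, ?_, Or.inr ?_⟩
    · by_contra! hle
      have := T.apply_le_apply (c := y) (d := x) (by omega) (by omega) hxm
      omega
    · refine ⟨by omega, ?_⟩
      by_contra! hle
      rcases hxc with hxc | hxc
      · have := T.apply_lt_apply hxc hle hxm
        omega
      · omega
  push Not at hA hB
  -- In the remaining case the changed cell is the last `i` of `T` and the first `i + 1` of `T'`.
  exfalso
  have hci := h.entry_eq
  have hci' := h.entry_eq'
  have hleft : ∀ e ∈ μ.cells, e ≠ c → T e.1 e.2 = i → e.2 < c.2 := by
    intro e he hec hei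
    rcases h.mem_iff.1 he with h1 | h1 | h1
    · have hec := hl e h1
      simp only [ReadBefore] at hec
      by_contra! hle
      rcases hec with hec | hec
      · have := T.apply_lt_apply hec hle he
        omega
      · omega
    · exact absurd h1 hec
    · exact absurd hei (hA e h1)
  have hright : ∀ e ∈ μ.cells, e ≠ c → T e.1 e.2 = i + 1 → c.2 < e.2 := by
    intro e he hec hei
    refine lt_of_le_of_ne (hB e he hei) fun heq => hec ?_
    exact (eq_of_apply_eq h.mem he (by rw [hci', h.apply_eq he hec, hei]) heq).symm
  refine hne (hU.eq_of_lt_iff hV fun a ha b hb => ?_)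
  rw [hTU a ha b hb, hTV a ha b hb]
  by_cases hac : a = c
  · subst hac
    by_cases hbc : b = a
    · subst hbc
      omega
    · have h1 := hleft b hb hbc
      have h2 := hright b hb hbc
      have h3 := h.apply_eq hb hbc
      omega
  · have h1 := hleft a ha hac
    have h2 := hright a ha hac
    have h3 := h.apply_eq ha hac
    by_cases hbc : b = c
    · subst hbc
      omega
    · have h4 := h.apply_eq hb hbc
      omega

namespace SplitMove

variable {μ : YoungDiagram} {i : ℕ} {T T' : SemistandardYoungTableau μ} {c x y : ℕ × ℕ}

theorem entry_x' (h : SplitMove i T T' c x y) : T' x.1 x.2 = i :=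
  (h.apply_eq x h.mem_x h.x_ne).trans h.entry_x

theorem entry_y' (h : SplitMove i T T' c x y) : T' y.1 y.2 = i + 1 :=
  (h.apply_eq y h.mem_y h.y_ne).trans h.entry_y

theorem succ_mem_bandStarts (h : SplitMove i T T' c x y) : i + 1 ∈ bandStarts T :=
  _root_.succ_mem_bandStarts h.mem_x h.mem_y h.entry_x h.entry_y h.row_lt

theorem succ_mem_bandStarts' (h : SplitMove i T T' c x y) : i + 1 ∈ bandStarts T' :=
  _root_.succ_mem_bandStarts h.mem_x h.mem_y h.entry_x' h.entry_y' h.row_lt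

theorem apply_cases (h : SplitMove i T T' c x y) {e : ℕ × ℕ} (he : e ∈ μ.cells) :
    T' e.1 e.2 = T e.1 e.2 ∨ (T e.1 e.2 = i ∧ T' e.1 e.2 = i + 1) := by
  by_cases hec : e = c
  · subst hec
    exact Or.inr ⟨h.entry_eq, h.entry_eq'⟩
  · exact Or.inl (h.apply_eq e he hec)

theorem self_mem_entrySet (h : SplitMove i T T' c x y) : i ∈ entrySet T :=
  mem_entrySet.2 ⟨x, h.mem_x, h.entry_x⟩

theorem succ_mem_entrySet (h : SplitMove i T T' c x y) : i + 1 ∈ entrySet T :=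
  mem_entrySet.2 ⟨y, h.mem_y, h.entry_y⟩

theorem entrySet_eq (h : SplitMove i T T' c x y) : entrySet T' = entrySet T := by
  ext v
  rw [mem_entrySet]
  constructor
  · rintro ⟨e, he, rfl⟩
    rcases h.apply_cases he with h1 | h1
    · rw [h1]
      exact mem_entrySet_of_mem he
    · rw [h1.2]
      exact h.succ_mem_entrySet
  · rw [mem_entrySet]
    rintro ⟨e, he, rfl⟩
    rcases h.apply_cases he with h1 | h1
    · exact ⟨e, he, h1⟩
    · exact ⟨x, h.mem_x, h1.1 ▸ h.entry_x'⟩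

theorem isHorizontalBand_of_le (h : SplitMove i T T' c x y) {u v : ℕ} (hv : v ≤ i)
    (hb : IsHorizontalBand T u v) : IsHorizontalBand T' u v := by
  intro a ha b hb' h1 h2 h3
  have := h.apply_cases ha
  have := h.apply_cases hb'
  exact hb a ha b hb' (by omega) (by omega) (by omega)

theorem isHorizontalBand_of_lt' (h : SplitMove i T T' c x y) {u v : ℕ} (hv : v < i)
    (hb : IsHorizontalBand T' u v) : IsHorizontalBand T u v := by
  intro a ha b hb' h1 h2 h3
  have := h.apply_cases ha
  have := h.apply_cases hb'
  exact hb a ha b hb' (by omega) (by omega) (by omega)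

theorem isHorizontalBand_of_lt (h : SplitMove i T T' c x y) {u v : ℕ} (hu : i + 1 < u)
    (hb : IsHorizontalBand T u v) : IsHorizontalBand T' u v := by
  intro a ha b hb' h1 h2 h3
  have := h.apply_cases ha
  have := h.apply_cases hb'
  exact hb a ha b hb' (by omega) (by omega) (by omega)

theorem isHorizontalBand_of_le' (h : SplitMove i T T' c x y) {u v : ℕ} (hu : i + 1 ≤ u)
    (hb : IsHorizontalBand T' u v) : IsHorizontalBand T u v := by
  intro a ha b hb' h1 h2 h3
  have := h.apply_cases ha
  have := h.apply_cases hb'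
  exact hb a ha b hb' (by omega) (by omega) (by omega)

/-- Only `i` can cease to start a band. -/
theorem eq_of_mem_of_notMem (h : SplitMove i T T' c x y) {v : ℕ} (hv : v ∈ bandStarts T)
    (hv' : v ∉ bandStarts T') : v = i := by
  by_contra hvi
  have hvm : v ∈ entrySet T' := h.entrySet_eq ▸ (mem_bandStarts.1 hv).1
  rcases lt_trichotomy v (i + 1) with hlt | rfl | hlt
  · obtain ⟨u, hu, huv, hb⟩ := exists_isHorizontalBand_of_notMem_bandStarts hvm hv'
    exact (mem_bandStarts.1 hv).2 u (h.entrySet_eq ▸ hu) huv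
      (h.isHorizontalBand_of_lt' (by omega) hb)
  · exact hv' h.succ_mem_bandStarts'
  · obtain ⟨u, hu, hiu, huv, hb⟩ := exists_isHorizontalBand_ge
      (h.entrySet_eq ▸ h.succ_mem_entrySet) hvm hlt hv'
    exact (mem_bandStarts.1 hv).2 u (h.entrySet_eq ▸ hu) huv (h.isHorizontalBand_of_le' hiu hb)

theorem lt_of_mem_of_notMem (h : SplitMove i T T' c x y) {v : ℕ} (hv : v ∈ bandStarts T')
    (hv' : v ∉ bandStarts T) : i + 1 < v := by
  by_contra! hle
  have hvm : v ∈ entrySet T := h.entrySet_eq ▸ (mem_bandStarts.1 hv).1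
  rcases hle.eq_or_lt with rfl | hlt
  · exact hv' h.succ_mem_bandStarts
  · obtain ⟨u, hu, huv, hb⟩ := exists_isHorizontalBand_of_notMem_bandStarts hvm hv'
    exact (mem_bandStarts.1 hv).2 u (h.entrySet_eq ▸ hu) huv
      (h.isHorizontalBand_of_le (by omega) hb)

/-- Only the least entry greater than `i + 1` can become the start of a band. -/
theorem eq_of_mem_of_notMem' (h : SplitMove i T T' c x y) {v w : ℕ} (hv : v ∈ bandStarts T')
    (hv' : v ∉ bandStarts T) (hw : w ∈ bandStarts T') (hw' : w ∉ bandStarts T) : v = w := by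
  wlog hvw : v < w generalizing v w
  · rcases (not_lt.1 hvw).eq_or_lt with h1 | h1
    · exact h1.symm
    · exact (this hw hw' hv hv' h1).symm
  have hvm : v ∈ entrySet T := h.entrySet_eq ▸ (mem_bandStarts.1 hv).1
  have hwm : w ∈ entrySet T := h.entrySet_eq ▸ (mem_bandStarts.1 hw).1
  have hiv := h.lt_of_mem_of_notMem hv hv'
  obtain ⟨u, hu, hvu, huw, hb⟩ := exists_isHorizontalBand_ge hvm hwm hvw hw'
  exact absurd (h.isHorizontalBand_of_lt (hiv.trans_le hvu) hb)
    ((mem_bandStarts.1 hw).2 u (h.entrySet_eq ▸ hu) huw)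

/-- The band starts of the two tableaux are nested: the changed cell cannot both be the
obstruction to joining the letters `i` to smaller entries in `T` and the obstruction to joining
greater entries to the letters `i + 1` in `T'`, because the cell `x` or the cell `y` would be
one too. -/
theorem bandStarts_subset_or_subset (h : SplitMove i T T' c x y) :
    bandStarts T ⊆ bandStarts T' ∨ bandStarts T' ⊆ bandStarts T := by
  by_contra! hcon
  obtain ⟨h1, h2⟩ := hcon
  obtain ⟨v, hv, hv'⟩ := Finset.not_subset.1 h1
  obtain ⟨w, hw, hw'⟩ := Finset.not_subset.1 h2
  obtain rfl := h.eq_of_mem_of_notMem hv hv'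
  have hiw := h.lt_of_mem_of_notMem hw hw'
  have hwm : w ∈ entrySet T := h.entrySet_eq ▸ (mem_bandStarts.1 hw).1
  obtain ⟨u, hu, huv, hb⟩ := exists_isHorizontalBand_of_notMem_bandStarts
    (h.entrySet_eq ▸ h.self_mem_entrySet) hv'
  obtain ⟨t, ht, hit, htw, hb'⟩ := exists_isHorizontalBand_ge h.succ_mem_entrySet hwm hiw hw'
  have hnb := (mem_bandStarts.1 hv).2 u (h.entrySet_eq ▸ hu) huv
  have hnb' := (mem_bandStarts.1 hw).2 t (h.entrySet_eq ▸ ht) htw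
  simp only [IsHorizontalBand, not_forall] at hnb hnb'
  obtain ⟨a, ha, b, hbm, ha1, hab, hbv, hnot⟩ := hnb
  obtain ⟨a', ha', b', hbm', ha1', hab', hbv', hnot'⟩ := hnb'
  have hbc : b = c := by
    by_contra hne
    have hac : a ≠ c := by
      rintro rfl
      have := h.entry_eq
      omega
    have hTa := h.apply_eq a ha hac
    have hTb := h.apply_eq b hbm hne
    exact hnot (hb a ha b hbm (by omega) (by omega) (by omega))
  have hac' : a' = c := by
    by_contra hne
    have hbc' : b' ≠ c := by
      rintro rfl
      have := h.entry_eq'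
      omega
    have hTa := h.apply_eq a' ha' hne
    have hTb := h.apply_eq b' hbm' hbc'
    exact hnot' (hb' a' ha' b' hbm' (by omega) (by omega) (by omega))
  subst hbc hac'
  have hc := h.entry_eq
  have hc' := h.entry_eq'
  have hx := h.entry_x'
  have hy := h.entry_y
  have hac : a ≠ a' := by
    rintro rfl
    omega
  have hbc' : b' ≠ a' := by
    rintro rfl
    omega
  have hTa := h.apply_eq a ha hac
  have hTb := h.apply_eq b' hbm' hbc'
  have hax := hb a ha x h.mem_x (by omega) (by omega) (by omega)
  have hyb := hb' y h.mem_y b' hbm' (by omega) (by omega) (by omega)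
  rcases h.position with hp | hp <;> omega

theorem card_le_card_add_one (h : SplitMove i T T' c x y) :
    (bandStarts T).card ≤ (bandStarts T').card + 1 := by
  have hsub : bandStarts T ⊆ insert i (bandStarts T') := by
    intro v hv
    by_cases hv' : v ∈ bandStarts T'
    · exact Finset.mem_insert_of_mem hv'
    · exact Finset.mem_insert.2 (Or.inl (h.eq_of_mem_of_notMem hv hv'))
  exact (Finset.card_le_card hsub).trans (Finset.card_insert_le _ _)

theorem card_le_card_add_one' (h : SplitMove i T T' c x y) :
    (bandStarts T').card ≤ (bandStarts T).card + 1 := by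
  have hcard : (bandStarts T' \ bandStarts T).card ≤ 1 := by
    refine Finset.card_le_one.2 fun v hv w hw => ?_
    rw [Finset.mem_sdiff] at hv hw
    exact h.eq_of_mem_of_notMem' hv.1 hv.2 hw.1 hw.2
  have := Finset.card_le_card_sdiff_add_card (s := bandStarts T') (t := bandStarts T)
  omega

end SplitMove

/-! ### Compression of tableaux -/

section Compression

variable {μ : YoungDiagram}

/-- The number of elements of `s` which are at most `v`. For a set `s` containing the band starts
of a tableau, composing its entries with `rankIn s` keeps its standardization. -/
def rankIn (s : Finset ℕ) (v : ℕ) : ℕ := (s.filter fun w => w ≤ v).card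

theorem rankIn_mono (s : Finset ℕ) {u v : ℕ} (h : u ≤ v) : rankIn s u ≤ rankIn s v :=
  Finset.card_le_card (Finset.monotone_filter_right _ fun _ _ hw => hw.trans h)

theorem rankIn_le_card (s : Finset ℕ) (v : ℕ) : rankIn s v ≤ s.card :=
  Finset.card_filter_le _ _

theorem notMem_of_rankIn_eq {s : Finset ℕ} {u v : ℕ} (h : rankIn s u = rankIn s v) (w : ℕ)
    (huw : u < w) (hwv : w ≤ v) : w ∉ s := by
  intro hw
  have hsub : insert w (s.filter fun w => w ≤ u) ⊆ s.filter fun w => w ≤ v := by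
    intro t ht
    rcases Finset.mem_insert.1 ht with rfl | ht
    · exact Finset.mem_filter.2 ⟨hw, hwv⟩
    · rw [Finset.mem_filter] at ht ⊢
      exact ⟨ht.1, by omega⟩
  have hcard := Finset.card_le_card hsub
  rw [Finset.card_insert_of_notMem (by simp; omega)] at hcard
  rw [rankIn, rankIn] at h
  omega

theorem rankIn_succ {s : Finset ℕ} {v : ℕ} (h : v + 1 ∈ s) : rankIn s (v + 1) = rankIn s v + 1 := by
  have : (s.filter fun w => w ≤ v + 1) = insert (v + 1) (s.filter fun w => w ≤ v) := by
    ext t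
    simp only [Finset.mem_filter, Finset.mem_insert]
    constructor
    · rintro ⟨h1, h2⟩
      rcases h2.eq_or_lt with h2 | h2
      · exact Or.inl h2
      · exact Or.inr ⟨h1, by omega⟩
    · rintro (rfl | h1)
      · exact ⟨h, le_rfl⟩
      · exact ⟨h1.1, by omega⟩
  rw [rankIn, this, Finset.card_insert_of_notMem (by simp), rankIn]

theorem rankIn_le_self {s : Finset ℕ} (hs : ∀ w ∈ s, 1 ≤ w) (v : ℕ) : rankIn s v ≤ v := by
  have hsub : s.filter (fun w => w ≤ v) ⊆ Finset.Icc 1 v := by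
    intro w hw
    rw [Finset.mem_filter] at hw
    exact Finset.mem_Icc.2 ⟨hs w hw.1, hw.2⟩
  simpa [rankIn] using Finset.card_le_card hsub

theorem isHorizontalBand_of_rankIn_eq {T : SemistandardYoungTableau μ} {s : Finset ℕ}
    (hs : bandStarts T ⊆ s) {u v : ℕ} (hu : u ∈ entrySet T) (hv : v ∈ entrySet T) (huv : u ≤ v)
    (h : rankIn s u = rankIn s v) : IsHorizontalBand T u v :=
  isHorizontalBand_of_forall_notMem hu hv huv fun w h1 h2 hw =>
    notMem_of_rankIn_eq h w h1 h2 (hs hw)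

theorem one_le_rankIn {T : SemistandardYoungTableau μ} {s : Finset ℕ} (hs : bandStarts T ⊆ s)
    {c : ℕ × ℕ} (hc : c ∈ μ.cells) : 1 ≤ rankIn s (T c.1 c.2) :=
  (bandIndex_pos hc).trans (Finset.card_le_card (Finset.filter_subset_filter _ hs))

theorem IsStandardization.exists_rankIn {T U : SemistandardYoungTableau μ}
    (h : IsStandardization T U) (hU : IsStandard U) {s : Finset ℕ} (hs : bandStarts T ⊆ s) :
    ∃ S : SemistandardYoungTableau μ, (∀ c ∈ μ.cells, S c.1 c.2 = rankIn s (T c.1 c.2)) ∧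
      IsStandardization S U := by
  refine hU.exists_isStandardization (fun c => rankIn s (T c.1 c.2)) fun c hc d hd hcd => ?_
  have hle := h.le hc hd hcd
  refine ⟨rankIn_mono s hle, fun heq => ?_⟩
  rcases hle.eq_or_lt with h1 | h1
  · exact h.northEast hc hd hcd h1
  · exact isHorizontalBand_of_rankIn_eq hs (mem_entrySet_of_mem hc) (mem_entrySet_of_mem hd) hle
      heq c hc d hd le_rfl h1 le_rfl

/-- Compressing the entries turns a crystal edge labelled `i` into a crystal edge labelled by the
rank of `i`. Cells merged with the letters `i` are read before the changed cell, and cells merged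
with the letters `i + 1` are read after it, so that the coupling conditions remain true. -/
theorem CrystalMove.compress {i : ℕ} {T T' S S' : SemistandardYoungTableau μ}
    {l r : List (ℕ × ℕ)} {c : ℕ × ℕ} (h : CrystalMove i T T' l c r) {s : Finset ℕ}
    (hs : bandStarts T ⊆ s) (hs' : bandStarts T' ⊆ s) (hi : i + 1 ∈ s)
    (hS : ∀ c ∈ μ.cells, S c.1 c.2 = rankIn s (T c.1 c.2))
    (hS' : ∀ c ∈ μ.cells, S' c.1 c.2 = rankIn s (T' c.1 c.2)) :
    CrystalMove (rankIn s i) S S' l c r := by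
  obtain ⟨-, -, hl, hr⟩ := h.pairwise
  have hml : ∀ e ∈ l, e ∈ μ.cells := fun e he => h.mem_iff.2 (Or.inl he)
  have hmr : ∀ e ∈ r, e ∈ μ.cells := fun e he => h.mem_iff.2 (Or.inr (Or.inr he))
  have hc := h.entry_eq
  have hc' := h.entry_eq'
  refine ⟨h.cells_eq, by rw [hS c h.mem, h.entry_eq], by rw [hS' c h.mem, h.entry_eq',
    rankIn_succ hi], fun e he => ?_, fun e he => ?_, fun t ht => ?_, fun t ht => ?_⟩
  · rw [hS e (hml e he), hS' e (hml e he), h.entry_left e he]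
  · rw [hS e (hmr e he), hS' e (hmr e he), h.entry_right e he]
  · have h1 : entryCount S (rankIn s i + 1) t ≤ entryCount T (i + 1) t := by
      refine List.countP_mono_left fun e he hei => ?_
      have hel := ht.subset he
      have hem := hml e hel
      simp only [decide_eq_true_eq] at hei ⊢
      rw [hS e hem, ← rankIn_succ hi] at hei
      rcases lt_trichotomy (T e.1 e.2) (i + 1) with hlt | heq | hgt
      · have := rankIn_mono s (Nat.lt_succ_iff.1 hlt)
        rw [rankIn_succ hi] at hei
        omega
      · exact heq
      · have he' := h.entry_left e hel
        rw [← he', ← hc'] at hei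
        have := isHorizontalBand_of_rankIn_eq hs' (mem_entrySet_of_mem h.mem)
          (mem_entrySet_of_mem hem) (by omega) hei.symm c h.mem e hem le_rfl (by omega) le_rfl
        have hec := hl e hel
        simp only [ReadBefore] at hec
        omega
    have h2 : entryCount T i t ≤ entryCount S (rankIn s i) t := by
      refine List.countP_mono_left fun e he hei => ?_
      simp only [decide_eq_true_eq] at hei ⊢
      rw [hS e (hml e (ht.subset he)), hei]
    exact h1.trans ((h.suffix_le t ht).trans h2)
  · have h1 : entryCount S (rankIn s i) t ≤ entryCount T i t := by
      refine List.countP_mono_left fun e he hei => ?_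
      have her := ht.subset he
      have hem := hmr e her
      simp only [decide_eq_true_eq] at hei ⊢
      rw [hS e hem] at hei
      rcases lt_trichotomy (T e.1 e.2) i with hlt | heq | hgt
      · rw [← hc] at hei
        have := isHorizontalBand_of_rankIn_eq hs (mem_entrySet_of_mem hem)
          (mem_entrySet_of_mem h.mem) (by omega) hei e hem c h.mem le_rfl (by omega) le_rfl
        have hce := hr e her
        simp only [ReadBefore] at hce
        omega
      · exact heq
      · have := rankIn_mono s (Nat.succ_le_iff.2 hgt)
        rw [Nat.succ_eq_add_one, rankIn_succ hi] at this
        omega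
    have h2 : entryCount T (i + 1) t ≤ entryCount S (rankIn s i + 1) t := by
      refine List.countP_mono_left fun e he hei => ?_
      simp only [decide_eq_true_eq] at hei ⊢
      rw [hS e (hmr e (ht.subset he)), hei, rankIn_succ hi]
    exact h1.trans ((h.prefix_le t ht).trans h2)

end Compression

/-! ### The skeleton -/

section Skeleton

variable {μ : YoungDiagram}

theorem card_bandStarts_eq_of_mem_subcomponent {n : ℕ} {U : StandardTableau μ}
    {T : SemistandardYoungTableau μ} (hT : T ∈ subcomponent n U) :
    (bandStarts T).card = (bandStarts U.1).card := by
  rw [← length_minimalParsing, ← length_minimalParsing, hT.2]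

theorem card_bandStarts_le_of_mem_subcomponent {n : ℕ} {U : StandardTableau μ}
    {T : SemistandardYoungTableau μ} (hT : T ∈ subcomponent n U) :
    (bandStarts U.1).card ≤ n := by
  rw [← card_bandStarts_eq_of_mem_subcomponent hT]
  have hsub : bandStarts T ⊆ Finset.Icc 1 n := by
    intro v hv
    obtain ⟨c, hc, rfl⟩ := mem_entrySet.1 (mem_bandStarts.1 hv).1
    exact Finset.mem_Icc.2 (hT.1 c hc)
  simpa using Finset.card_le_card hsub

theorem mem_skeleton_verts {n : ℕ} {U : StandardTableau μ} :
    U ∈ (skeleton μ n).verts ↔ (bandStarts U.1).card ≤ n := by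
  constructor
  · rintro ⟨T, hT⟩
    exact card_bandStarts_le_of_mem_subcomponent hT
  · intro h
    obtain ⟨S, hS, hSU⟩ := U.2.isStandardization_self.exists_rankIn U.2
      (subset_refl (bandStarts U.1))
    refine ⟨S, fun c hc => ?_, hSU.minimalParsing_eq U.2⟩
    rw [hS c hc]
    exact ⟨one_le_rankIn subset_rfl hc, (rankIn_le_card _ _).trans h⟩

theorem linkLabels_mono {n N : ℕ} (h : n ≤ N) (U V : StandardTableau μ) :
    linkLabels n U V ⊆ linkLabels N U V := by
  have hle : ∀ T : SemistandardYoungTableau μ, T ∈ (crystal μ n).verts → T ∈ (crystal μ N).verts :=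
    fun T hT c hc => ⟨(hT c hc).1, (hT c hc).2.trans h⟩
  rintro i ⟨T, hT, T', hT', h1, h2, h3, h4, h5⟩
  exact ⟨T, ⟨hle T hT.1, hT.2⟩, T', ⟨hle T' hT'.1, hT'.2⟩, hle T h1, hle T' h2, h3, h4.trans_le h,
    h5⟩

theorem exists_moves_of_mem_linkLabels {N i : ℕ} {U V : StandardTableau μ} (hne : U ≠ V)
    (hi : i ∈ linkLabels N U V) :
    ∃ T ∈ subcomponent N U, ∃ T' ∈ subcomponent N V, ∃ l c r x y,
      CrystalMove i T T' l c r ∧ SplitMove i T T' c x y := by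
  obtain ⟨T, hT, T', hT', -, -, -, -, hedge⟩ := hi
  obtain ⟨l, c, r, hm⟩ := crystalF_rowWord_iff.1 hedge
  obtain ⟨x, y, hsplit⟩ := hm.exists_splitMove U.2 V.2
    (isStandardization_of_minimalParsing_eq U.2 hT.2)
    (isStandardization_of_minimalParsing_eq V.2 hT'.2) (fun h => hne (Subtype.ext h))
  exact ⟨T, hT, T', hT', l, c, r, x, y, hm, hsplit⟩

/-- An edge of the crystal between two different subcomponents can be compressed, without
increasing its label, to any number of letters for which both subcomponents occur. The new
entries are the ranks with respect to the union of the two sets of band starts; since these sets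
are nested, the ranks do not exceed the larger number of bands. -/
theorem exists_le_mem_linkLabels {n N i : ℕ} {U V : StandardTableau μ} (hne : U ≠ V)
    (hU : (bandStarts U.1).card ≤ n) (hV : (bandStarts V.1).card ≤ n)
    (hi : i ∈ linkLabels N U V) : ∃ j ≤ i, j ∈ linkLabels n U V := by
  obtain ⟨T, hT, T', hT', l, c, r, x, y, hm, hsplit⟩ := exists_moves_of_mem_linkLabels hne hi
  rw [← card_bandStarts_eq_of_mem_subcomponent hT] at hU
  rw [← card_bandStarts_eq_of_mem_subcomponent hT'] at hV
  set s := bandStarts T ∪ bandStarts T' with hs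
  have hTs : bandStarts T ⊆ s := Finset.subset_union_left
  have hTs' : bandStarts T' ⊆ s := Finset.subset_union_right
  have hcard : s.card ≤ n := by
    rcases hsplit.bandStarts_subset_or_subset with h | h
    · rwa [hs, Finset.union_eq_right.2 h]
    · rwa [hs, Finset.union_eq_left.2 h]
  have hpos : ∀ w ∈ s, 1 ≤ w := by
    intro w hw
    have hwT : w ∈ entrySet T := by
      rcases Finset.mem_union.1 hw with h | h
      · exact (mem_bandStarts.1 h).1
      · exact hsplit.entrySet_eq ▸ (mem_bandStarts.1 h).1
    obtain ⟨e, he, rfl⟩ := mem_entrySet.1 hwT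
    exact (hT.1 e he).1
  obtain ⟨S, hS, hSU⟩ := (isStandardization_of_minimalParsing_eq U.2 hT.2).exists_rankIn U.2 hTs
  obtain ⟨S', hS', hSV⟩ :=
    (isStandardization_of_minimalParsing_eq V.2 hT'.2).exists_rankIn V.2 hTs'
  have his : i + 1 ∈ s := hTs hsplit.succ_mem_bandStarts
  have hm' := hm.compress hTs hTs' his hS hS'
  have hSn : S ∈ (crystal μ n).verts := fun e he => by
    rw [hS e he]
    exact ⟨one_le_rankIn hTs he, (rankIn_le_card _ _).trans hcard⟩
  have hSn' : S' ∈ (crystal μ n).verts := fun e he => by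
    rw [hS' e he]
    exact ⟨one_le_rankIn hTs' he, (rankIn_le_card _ _).trans hcard⟩
  refine ⟨rankIn s i, rankIn_le_self hpos i, S, ⟨hSn, hSU.minimalParsing_eq U.2⟩, S',
    ⟨hSn', hSV.minimalParsing_eq V.2⟩, hSn, hSn', ?_, ?_, crystalF_rowWord_iff.2 ⟨l, c, r, hm'⟩⟩
  · have := (hSn c hm.mem).1
    rwa [hm'.entry_eq] at this
  · have := (hSn' c hm.mem).2
    rw [hm'.entry_eq'] at this
    omega

theorem isLeast_linkLabels_iff {n N : ℕ} (h : n ≤ N) {U V : StandardTableau μ} (hne : U ≠ V)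
    (hU : (bandStarts U.1).card ≤ n) (hV : (bandStarts V.1).card ≤ n) (i : ℕ) :
    IsLeast (linkLabels n U V) i ↔ IsLeast (linkLabels N U V) i := by
  have hmono := linkLabels_mono h U V
  constructor
  · rintro ⟨h1, h2⟩
    refine ⟨hmono h1, fun j hj => ?_⟩
    obtain ⟨k, hkj, hk⟩ := exists_le_mem_linkLabels hne hU hV hj
    exact (h2 hk).trans hkj
  · rintro ⟨h1, h2⟩
    obtain ⟨k, hki, hk⟩ := exists_le_mem_linkLabels hne hU hV h1
    obtain rfl := le_antisymm hki (h2 (hmono hk))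
    exact ⟨hk, fun j hj => h2 (hmono hj)⟩

/-- With fewer letters, the skeleton is the induced subgraph on the subcomponents which still
occur. -/
theorem skeleton_eq_induce {n N : ℕ} (h : n ≤ N) :
    skeleton μ n = (skeleton μ N).induce {U | (bandStarts U.1).card ≤ n} := by
  refine LabelledDigraph.ext ?_ ?_
  · ext U
    exact mem_skeleton_verts
  · funext U i V
    refine propext ⟨fun hedge => ?_, ?_⟩
    · have hverts := (skeleton μ n).edge_mem U i V hedge
      have hU := mem_skeleton_verts.1 hverts.1
      have hV := mem_skeleton_verts.1 hverts.2
      exact ⟨hU, hV, hedge.1, (isLeast_linkLabels_iff h hedge.1 hU hV i).1 hedge.2⟩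
    · rintro ⟨hU, hV, hne, hleast⟩
      exact ⟨hne, (isLeast_linkLabels_iff h hne hU hV i).2 hleast⟩

theorem card_bandStarts_le_maxDescentLength (U : StandardTableau μ) :
    (bandStarts U.1).card ≤ maxDescentLength μ :=
  (maxDescentLength_isGreatest μ).2
    ⟨U.1, fun _ hc => (U.2.mapsTo (Finset.mem_coe.2 hc)).1, length_descentComposition⟩

end Skeleton

theorem mainTheorem6 (μ : YoungDiagram) :
    (∀ n : ℕ, maxDescentLength μ ≤ n →
      skeleton μ n = skeleton μ (maxDescentLength μ)) ∧
    (∀ n : ℕ, 1 ≤ n → n ≤ maxDescentLength μ →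
      skeleton μ n =
        (skeleton μ (maxDescentLength μ)).induce
          {U : StandardTableau μ | (descentComposition U.1).length ≤ n}) ∧
    (∀ (U V : StandardTableau μ) (i : ℕ),
      (skeleton μ (maxDescentLength μ)).edge U i V →
        (descents U).card ≤ (descents V).card + 1 ∧
        (descents V).card ≤ (descents U).card + 1) := by
  refine ⟨fun n hn => ?_, fun n _ hn => ?_, fun U V i hedge => ?_⟩
  · have hall : {U : StandardTableau μ | (bandStarts U.1).card ≤ maxDescentLength μ} = Set.univ :=
      Set.eq_univ_of_forall card_bandStarts_le_maxDescentLength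
    rw [skeleton_eq_induce hn, hall]
    refine LabelledDigraph.ext ?_ ?_
    · exact Set.eq_univ_of_forall fun U =>
        mem_skeleton_verts.2 ((card_bandStarts_le_maxDescentLength U).trans hn)
    · funext U i V
      exact propext ⟨fun h => ⟨trivial, trivial, h⟩, fun h => h.2.2⟩
  · simp only [length_descentComposition]
    exact skeleton_eq_induce hn
  · obtain ⟨T, hT, T', hT', _, c, _, _, _, hm, hsplit⟩ :=
      exists_moves_of_mem_linkLabels hedge.1 hedge.2.1
    have hU := card_bandStarts_eq_card_descents_add_one U ⟨c, hm.mem⟩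
    have hV := card_bandStarts_eq_card_descents_add_one V ⟨c, hm.mem⟩
    rw [← card_bandStarts_eq_of_mem_subcomponent hT] at hU
    rw [← card_bandStarts_eq_of_mem_subcomponent hT'] at hV
    have h1 := hsplit.card_le_card_add_one
    have h2 := hsplit.card_le_card_add_one'
    omega
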